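/- Let $x_1,x_2,\dots$, $\alpha_1,\alpha_2,\dots$ and $\beta_1,\beta_2,\dots$ be formal variables. For a partition $\lambda=(\lambda_1\ge\dots\ge\lambda_n\ge 0)$ with at most $n$ parts let $$G_\lambda(\mathbf x_n;\boldsymbol\alpha,\boldsymbol\beta)=\frac{\det\left(x_j^{\lambda_i+n-i}\,\dfrac{(1-\beta_1x_j)\cdots(1-\beta_{i-1}x_j)}{(1-\alpha_1x_j)\cdots(1-\alpha_{\lambda_i}x_j)}\right)_{1\le i,j\le n}}{\prod_{1\le i<j\le n}(x_i-x_j)}$$ be the refined canonical stable Grothendieck polynomial. A marked multiset-valued tableau of shape $\lambda$ is a filling $T$ of the cells $(i,j)$ of the Young diagram of $\lambda$ such that each $T(i,j)$ is a nonempty finite multiset $\{a_1\le\dots\le a_k\}$ of positive integers, in which each $a_m$ with $m\ge2$ and $a_{m-1}<a_m$ may be marked, and such that $\max T(i,j)\le\min T(i,j+1)$ and $\max T(i,j)<\min T(i+1,j)$ whenever both cells involved belong to $\lambda$. Let $\mathrm{MMSVT}(\lambda)$ be the set of these tableaux and $$\mathrm{wt}(T)=\prod_{(i,j)\in\lambda}\Big(\prod_{a\in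 T(i,j)}x_a\Big)\,\alpha_j^{\mathrm{unmarked}(T(i,j))-1}\,(-\beta_i)^{\mathrm{marked}(T(i,j))},$$ where $a$ runs over all elements of $T(i,j)$, marked or not, with multiplicity, and $\mathrm{unmarked}(T(i,j))$ and $\mathrm{marked}(T(i,j))$ are the numbers of unmarked and marked elements of $T(i,j)$. Then, for every $n\ge 0$ and every partition $\lambda$ with at most $n$ parts, $$G_\lambda(\mathbf x_n;\boldsymbol\alpha,\boldsymbol\beta)=\sum_{T\in\mathrm{MMSVT}(\lambda),\ \max(T)\le n}\mathrm{wt}(T)$$ as formal power series, where $\max(T)$ is the largest integer appearing in $T$, and the condition $\max(T)\le n$ holds for the empty tableau. -/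

import Mathlib

open scoped MvPowerSeries.WithPiTopology

/-- The formal variables `x_k`, `α_k`, `β_k`. Only the indices `k ≥ 1` are ever used. -/
inductive GVar : Type
  | x (k : ℕ)
  | alpha (k : ℕ)
  | beta (k : ℕ)

/-- Formal power series with integer coefficients in all the variables `x_k`, `α_k`, `β_k`. -/
abbrev GRing : Type := MvPowerSeries GVar ℤ

instance : IsDomain GRing := NoZeroDivisors.to_isDomain _

/-- The fraction field of the ring of formal power series. -/
abbrev GField : Type := FractionRing GRing

noncomputable section

namespace GRing

/-- The variable `x_k`. -/
def x (k : ℕ) : GRing := MvPowerSeries.X (GVar.x k)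

/-- The variable `α_k`. -/
def a (k : ℕ) : GRing := MvPowerSeries.X (GVar.alpha k)

/-- The variable `β_k`. -/
def b (k : ℕ) : GRing := MvPowerSeries.X (GVar.beta k)

end GRing

namespace GField

/-- The variable `x_k`, in the fraction field. -/
def x (k : ℕ) : GField := algebraMap GRing GField (GRing.x k)

/-- The variable `α_k`, in the fraction field. -/
def a (k : ℕ) : GField := algebraMap GRing GField (GRing.a k)

/-- The variable `β_k`, in the fraction field. -/
def b (k : ℕ) : GField := algebraMap GRing GField (GRing.b k)

end GField

/-- The refined canonical stable Grothendieck polynomial `G_λ(x_1, …, x_n; α, β)`, for a partition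
`λ` with at most `n` parts: a quotient of two alternants in the fraction field.
Rows and columns are numbered from `0` here (in `Fin n` and in `YoungDiagram`), so `i` and `j` stand
for the row `i + 1` and the column `j + 1`, and `lam.rowLen i` is the part `λ_{i+1}`. -/
def refinedG (n : ℕ) (lam : YoungDiagram) : GField :=
  (Matrix.of fun i j : Fin n =>
      GField.x (j + 1) ^ (lam.rowLen i + n - (i + 1)) *
        ((∏ k ∈ Finset.Icc 1 (i : ℕ), (1 - GField.b k * GField.x (j + 1))) /
          ∏ k ∈ Finset.Icc 1 (lam.rowLen i), (1 - GField.a k * GField.x (j + 1)))).det /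
    ∏ i : Fin n, ∏ j ∈ Finset.Ioi i, (GField.x (i + 1) - GField.x (j + 1))

/-- A nonempty finite multiset `{a_1 ≤ … ≤ a_k}` of positive integers in which `a_i` may be marked
if `i ≥ 2` and `a_{i-1} < a_i`. It is given by the list of its elements in weakly increasing order;
an element is a pair of an integer and a Boolean that tells whether the integer is marked. -/
structure IsMarkedMultiset (L : List (ℕ × Bool)) : Prop where
  ne_nil : L ≠ []
  pos : ∀ p ∈ L, 0 < p.1
  head_unmarked : ∀ p ∈ L.head?, p.2 = false
  chain : L.IsChain fun p q => p.1 ≤ q.1 ∧ (q.2 = true → p.1 < q.1)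

/-- Marked multiset-valued tableaux of shape `λ`. The cells are numbered from `0`, and `entry i j`
is the empty list if `(i, j)` is not a cell. As the entries of cells are not empty, the conditions
`row_weak` and `col_strict` compare the maximum of a cell with the minimum of the next one. -/
@[ext]
structure MMSVT (lam : YoungDiagram) where
  entry : ℕ → ℕ → List (ℕ × Bool)
  outside : ∀ i j, (i, j) ∉ lam → entry i j = []
  cell : ∀ i j, (i, j) ∈ lam → IsMarkedMultiset (entry i j)
  row_weak : ∀ i j, (i, j + 1) ∈ lam →
    ∀ p ∈ entry i j, ∀ q ∈ entry i (j + 1), p.1 ≤ q.1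
  col_strict : ∀ i j, (i + 1, j) ∈ lam →
    ∀ p ∈ entry i j, ∀ q ∈ entry (i + 1) j, p.1 < q.1

namespace MMSVT

variable {lam : YoungDiagram}

/-- The number of unmarked integers in the cell `(i, j)`; it is at least `1` if this is a cell. -/
def unmarked (T : MMSVT lam) (i j : ℕ) : ℕ := (T.entry i j).countP fun p => p.2 = false

/-- The number of marked integers in the cell `(i, j)`. -/
def marked (T : MMSVT lam) (i j : ℕ) : ℕ := (T.entry i j).countP fun p => p.2 = true

/-- The product over all cells `(i, j)`, numbered from `1`, of
`x^{T(i,j)} α_j^{unmarked(T(i,j)) - 1} (-β_i)^{marked(T(i,j))}`. -/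
def wt (T : MMSVT lam) : GRing :=
  ∏ c ∈ lam.cells,
    ((T.entry c.1 c.2).map fun p => GRing.x p.1).prod *
      GRing.a (c.2 + 1) ^ (T.unmarked c.1 c.2 - 1) *
      (-GRing.b (c.1 + 1)) ^ T.marked c.1 c.2

/-- `max(T) ≤ n`: all integers in `T`, marked or not, are at most `n`. -/
def MaxLE (T : MMSVT lam) (n : ℕ) : Prop := ∀ i j, ∀ p ∈ T.entry i j, p.1 ≤ n

end MMSVT

end

/-! Both sides obey the same recursion on `n`, which removes the last variable y = x_{n+1} and sums
over the shapes μ with λ_{i+1} ≤ μ_i ≤ λ_i.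

On tableaux, erase all letters n+1 and let μ be the shape that remains. A cell outside μ held only
unmarked copies of n+1 and contributes y/(1-α_j y). The last cell of a row of μ, if no cell of λ
lies below it, may have held further copies, the first of them marked or not; this gives 1 +
(α_j-β_i)y/(1-α_j y) = (1-β_i y)/(1-α_j y). No other cell can contain n+1. This is
`hasSum_extension` and `hasSum_fillingWt`.

On alternants, subtract from each row the multiple of the next one that kills the last column. The
new entries have a factor x_j-y, and what is left of row i is (1-β_i y)⁻¹ times a combination of
entries of size n with parts m in [λ_{i+1}, λ_i], whose coefficients are exactly the cell factors
above (`alternantEntry_sub`). Multilinearity turns this into a sum over μ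
(`alternantQuotient_succ`). The two recursions are compared in `algebraMap_fillingSeries`. -/

/-! ### Branching rule for quotients of alternants -/

section Branching

variable {K : Type*} [Field K]

/-- The entry of the alternant in row `i` (numbered from `0`) with part `l`, at the variable `z`. -/
def alternantEntry (a b : ℕ → K) (n i l : ℕ) (z : K) : K :=
  z ^ (l + n - (i + 1)) *
    ((∏ k ∈ Finset.Icc 1 i, (1 - b k * z)) / ∏ k ∈ Finset.Icc 1 l, (1 - a k * z))

/-- The quotient of alternants for the shape `l`. -/
def alternantQuotient (x a b : ℕ → K) (n : ℕ) (l : ℕ → ℕ) : K :=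
  (Matrix.of fun i j : Fin n => alternantEntry a b n i (l i) (x (j + 1))).det /
    ∏ i : Fin n, ∏ j ∈ Finset.Ioi i, (x (i + 1) - x (j + 1))

/-- The contribution to the branching rule of the cell in row `i` and column `j`, numbered from `0`,
of the shape `l` when the letters below the last one fill the shape `μ`. -/
def branchFactor (y : K) (a b : ℕ → K) (l μ : ℕ → ℕ) (i j : ℕ) : K :=
  if μ i ≤ j then y / (1 - a (j + 1) * y)
  else if j + 1 = μ i ∧ l (i + 1) ≤ j then (1 - b (i + 1) * y) / (1 - a (j + 1) * y)
  else 1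

/-- Extension by zero of a function on `Fin n`. -/
def extendZero {n : ℕ} (μ : Fin n → ℕ) (i : ℕ) : ℕ := if h : i < n then μ ⟨i, h⟩ else 0

/-- Shapes obtained from `l` by removing a horizontal strip, with at most `n` rows. -/
def interlacing (n : ℕ) (l : ℕ → ℕ) : Finset (Fin n → ℕ) :=
  Fintype.piFinset fun i => Finset.Icc (l (i + 1)) (l i)

theorem extendZero_fin {n : ℕ} (μ : Fin n → ℕ) (i : Fin n) : extendZero μ i = μ i := by
  simp [extendZero]

theorem extendZero_of_le {n : ℕ} (μ : Fin n → ℕ) {i : ℕ} (h : n ≤ i) : extendZero μ i = 0 := by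
  simp [extendZero, h]

/-- The row factor: cells `m ≤ j < p` contain only the last letter. -/
def rowFactor (y : K) (a : ℕ → K) (β : K) (q p m : ℕ) : K :=
  (∏ j ∈ Finset.Ico m p, y / (1 - a (j + 1) * y)) *
    if q < m then (1 - β * y) / (1 - a m * y) else 1

theorem prod_Ico_branchFactor (y : K) (a b : ℕ → K) (l μ : ℕ → ℕ) (i : ℕ)
    (h1 : l (i + 1) ≤ μ i) (h2 : μ i ≤ l i) :
    ∏ j ∈ Finset.range (l i), branchFactor y a b l μ i j =
      rowFactor y a (b (i + 1)) (l (i + 1)) (l i) (μ i) := by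
  rw [rowFactor, Finset.range_eq_Ico, ← Finset.prod_Ico_consecutive _ (Nat.zero_le _) h2, mul_comm]
  congr 1
  · refine Finset.prod_congr rfl fun j hj => ?_
    rw [branchFactor, if_pos (Finset.mem_Ico.mp hj).1]
  · split_ifs with h
    · obtain ⟨m, hm⟩ : ∃ m, μ i = m + 1 := ⟨μ i - 1, by omega⟩
      rw [hm, ← Finset.range_eq_Ico, Finset.prod_range_succ, Finset.prod_eq_one, one_mul,
        branchFactor, if_neg (by omega), if_pos (by omega)]
      intro j hj
      rw [Finset.mem_range] at hj
      rw [branchFactor, if_neg (by omega), if_neg (by omega)]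
    · refine Finset.prod_eq_one fun j hj => ?_
      rw [Finset.mem_Ico] at hj
      rw [branchFactor, if_neg (by omega), if_neg (by omega)]

/-- One-variable form of the branching identity for a row. -/
theorem sum_rowFactor_mul (a : ℕ → K) (β x y : K) (hx : ∀ k, 1 - a k * x ≠ 0)
    (hy : ∀ k, 1 - a k * y ≠ 0) (q p : ℕ) (hqp : q ≤ p) :
    (x - y) * ∑ m ∈ Finset.Icc q p, rowFactor y a β q p m *
        ∏ j ∈ Finset.Ico q m, x / (1 - a (j + 1) * x) =
      (1 - β * y) * x * ∏ j ∈ Finset.Ico q p, x / (1 - a (j + 1) * x) -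
        (1 - β * x) * y * ∏ j ∈ Finset.Ico q p, y / (1 - a (j + 1) * y) := by
  induction p, hqp using Nat.le_induction with
  | base => simp [rowFactor]; ring
  | succ p hqp ih =>
    -- Passing from p to p+1 multiplies every old term by the same factor; only the term m = p+1 is
    -- new.
    have h1 : ∑ m ∈ Finset.Icc q p, rowFactor y a β q (p + 1) m *
        ∏ j ∈ Finset.Ico q m, x / (1 - a (j + 1) * x) =
        (∑ m ∈ Finset.Icc q p, rowFactor y a β q p m *
          ∏ j ∈ Finset.Ico q m, x / (1 - a (j + 1) * x)) * (y / (1 - a (p + 1) * y)) := by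
      rw [Finset.sum_mul]
      refine Finset.sum_congr rfl fun m hm => ?_
      rw [rowFactor, Finset.prod_Ico_succ_top (Finset.mem_Icc.mp hm).2, rowFactor]
      ring
    have h2 : rowFactor y a β q (p + 1) (p + 1) = (1 - β * y) / (1 - a (p + 1) * y) := by
      rw [rowFactor, Finset.Ico_self, Finset.prod_empty, one_mul, if_pos (by omega)]
    rw [Finset.sum_Icc_succ_top (by omega), h1, h2, mul_add, ← mul_assoc, ih,
      Finset.prod_Ico_succ_top hqp, Finset.prod_Ico_succ_top hqp]
    have hxp := hx (p + 1)
    have hyp := hy (p + 1)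
    generalize a (p + 1) = c at hxp hyp ⊢
    generalize ∏ j ∈ Finset.Ico q p, x / (1 - a (j + 1) * x) = X
    generalize ∏ j ∈ Finset.Ico q p, y / (1 - a (j + 1) * y) = Y
    rw [mul_comm] at hxp hyp
    rw [mul_comm c, mul_comm c]
    field_simp
    ring

/-- Each unit added to the part adds one power of x and one factor of the denominator. The bound
`hi` prevents truncation in the exponent. -/
theorem alternantEntry_eq_mul_prod (a b : ℕ → K) (n i q m : ℕ) (x : K) (hqm : q ≤ m)
    (hi : i < n) :
    alternantEntry a b n i m x =
      alternantEntry a b n i q x * ∏ j ∈ Finset.Ico q m, x / (1 - a (j + 1) * x) := by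
  induction m, hqm using Nat.le_induction with
  | base => simp
  | succ m hqm ih =>
    rw [Finset.prod_Ico_succ_top hqm, ← mul_assoc, ← ih, alternantEntry, alternantEntry,
      Finset.prod_Icc_succ_top (by omega), show m + 1 + n - (i + 1) = m + n - (i + 1) + 1 by omega,
      pow_succ, ← div_div]
    ring

theorem alternantEntry_succ (a b : ℕ → K) (n i q : ℕ) (x : K) (hi : i < n) :
    alternantEntry a b (n + 1) i q x = alternantEntry a b n i q x * x := by
  rw [alternantEntry, alternantEntry, show q + (n + 1) - (i + 1) = q + n - (i + 1) + 1 by omega,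
    pow_succ]
  ring

/-- Row i+1 at size n+1 carries the same power of x as row i at size n, so adjacent rows can be
compared through entries of size n. -/
theorem alternantEntry_succ_succ (a b : ℕ → K) (n i q : ℕ) (x : K) :
    alternantEntry a b (n + 1) (i + 1) q x =
      alternantEntry a b n i q x * (1 - b (i + 1) * x) := by
  rw [alternantEntry, alternantEntry, Finset.prod_Icc_succ_top (by omega),
    show q + (n + 1) - (i + 1 + 1) = q + n - (i + 1) by omega]
  ring

theorem alternantEntry_ne_zero (a b : ℕ → K) (n i q : ℕ) (y : K)
    (hy : ∀ k, 1 - a k * y ≠ 0) (hb : ∀ k, 1 - b k * y ≠ 0) (hy0 : y ≠ 0) :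
    alternantEntry a b n i q y ≠ 0 :=
  mul_ne_zero (pow_ne_zero _ hy0) (div_ne_zero (Finset.prod_ne_zero_iff.mpr fun k _ => hb k)
    (Finset.prod_ne_zero_iff.mpr fun k _ => hy k))

/-- Once the entry of size n with part q is factored out at x and cancelled at y, the difference is
the right side of `sum_rowFactor_mul` divided by 1 - b (i+1) y. -/
theorem alternantEntry_sub (a b : ℕ → K) (n i q p : ℕ) (x y : K) (hx : ∀ k, 1 - a k * x ≠ 0)
    (hy : ∀ k, 1 - a k * y ≠ 0) (hb : ∀ k, 1 - b k * y ≠ 0) (hy0 : y ≠ 0)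
    (hqp : q ≤ p) (hi : i < n) :
    alternantEntry a b (n + 1) i p x -
        alternantEntry a b (n + 1) i p y / alternantEntry a b (n + 1) (i + 1) q y *
          alternantEntry a b (n + 1) (i + 1) q x =
      (x - y) * ((1 - b (i + 1) * y)⁻¹ * ∑ m ∈ Finset.Icc q p,
        rowFactor y a (b (i + 1)) q p m * alternantEntry a b n i m x) := by
  have h := sum_rowFactor_mul a (b (i + 1)) x y hx hy q p hqp
  have h1 : ∑ m ∈ Finset.Icc q p, rowFactor y a (b (i + 1)) q p m * alternantEntry a b n i m x =
      alternantEntry a b n i q x * ∑ m ∈ Finset.Icc q p, rowFactor y a (b (i + 1)) q p m *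
        ∏ j ∈ Finset.Ico q m, x / (1 - a (j + 1) * x) := by
    rw [Finset.mul_sum]
    refine Finset.sum_congr rfl fun m hm => ?_
    rw [alternantEntry_eq_mul_prod a b n i q m x (Finset.mem_Icc.mp hm).1 hi]
    ring
  rw [h1, mul_left_comm (1 - b (i + 1) * y)⁻¹, mul_left_comm (x - y),
    mul_left_comm (x - y), h, alternantEntry_succ a b n i p x hi, alternantEntry_succ a b n i p y hi,
    alternantEntry_succ_succ, alternantEntry_succ_succ,
    alternantEntry_eq_mul_prod a b n i q p x hqp hi,
    alternantEntry_eq_mul_prod a b n i q p y hqp hi]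
  have h2 := alternantEntry_ne_zero a b n i q y hy hb hy0
  have h3 := hb (i + 1)
  generalize 1 - b (i + 1) * y = c at h3 ⊢
  field_simp

theorem prod_sub_castSucc (x : ℕ → K) (n : ℕ) :
    ∏ i : Fin (n + 1), ∏ j ∈ Finset.Ioi i, (x (i + 1) - x (j + 1)) =
      (∏ i : Fin n, (x (i + 1) - x (n + 1))) *
        ∏ i : Fin n, ∏ j ∈ Finset.Ioi i, (x (i + 1) - x (j + 1)) := by
  have key : ∀ m (i : Fin m), ∏ j ∈ Finset.Ioi i, (x (i + 1) - x (j + 1)) =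
      ∏ j : Fin m, if i < j then x (i + 1) - x (j + 1) else 1 := by
    intro m i
    rw [← Finset.prod_filter]
    congr 1
    ext; simp
  simp only [key]
  rw [Fin.prod_univ_castSucc, ← Finset.prod_mul_distrib]
  have : ∀ j : Fin (n + 1), ¬ Fin.last n < j := fun j => not_lt.mpr (Fin.le_last j)
  simp only [this, if_false, Finset.prod_const_one, mul_one]
  refine Finset.prod_congr rfl fun i _ => ?_
  rw [Fin.prod_univ_castSucc, mul_comm]
  simp [Fin.castSucc_lt_last]

/-- Elimination of the last column by subtracting from each row a multiple of the next one. -/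
theorem det_eliminate_last {n : ℕ} (M : Matrix (Fin (n + 1)) (Fin (n + 1)) K)
    (h : ∀ i, M i (Fin.last n) ≠ 0) :
    M.det = M (Fin.last n) (Fin.last n) *
      (Matrix.of fun i j : Fin n => M i.castSucc j.castSucc -
        M i.castSucc (Fin.last n) / M i.succ (Fin.last n) * M i.succ j.castSucc).det := by
  let N : Matrix (Fin (n + 1)) (Fin (n + 1)) K := Matrix.of fun i => Fin.lastCases
    (motive := fun _ => Fin (n + 1) → K) (fun j => M (Fin.last n) j) (fun i j => M i.castSucc j -
        M i.castSucc (Fin.last n) / M i.succ (Fin.last n) * M i.succ j) i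
  have hN : M.det = N.det := by
    -- The row-operation lemma uses the preceding row; reversing rows and columns makes the next row
    -- the preceding one.
    rw [← Matrix.det_submatrix_equiv_self Fin.revPerm M,
      ← Matrix.det_submatrix_equiv_self Fin.revPerm N]
    refine Matrix.det_eq_of_forall_row_eq_smul_add_pred (fun i =>
      M i.rev.castSucc (Fin.last n) / M i.rev.succ (Fin.last n)) ?_ ?_
    · intro j
      simp [N]
    · intro i j
      simp [N, Fin.rev_succ, Fin.rev_castSucc]
  rw [hN, Matrix.det_succ_column N (Fin.last n), Fin.sum_univ_castSucc]
  have h0 : ∀ i : Fin n, N i.castSucc (Fin.last n) = 0 := by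
    intro i
    simp [N, div_mul_cancel₀ _ (h i.succ)]
  simp only [h0]
  simp only [mul_zero, zero_mul, Finset.sum_const_zero, zero_add]
  congr 1
  -- The cofactor sign is (-1)^(n+n) = 1.
  · simp [N, ← two_mul]
  · congr 1
    ext i j
    simp [N]

/-- Multilinearity in the rows: choosing one summand in each row amounts to choosing a shape μ. -/
theorem det_sum_rows {n : ℕ} (A : Fin n → Finset ℕ) (w : Fin n → ℕ → K)
    (h : Fin n → ℕ → Fin n → K) :
    (Matrix.of fun i j => ∑ m ∈ A i, w i m * h i m j).det =
      ∑ μ ∈ Fintype.piFinset A, (∏ i, w i (μ i)) * (Matrix.of fun i j => h i (μ i) j).det := by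
  have := (Matrix.detRowAlternating (R := K) (n := Fin n)).toMultilinearMap.map_sum_finset
    (fun i m => w i m • h i m) A
  have e : (Matrix.of fun i j => ∑ m ∈ A i, w i m * h i m j) =
      fun i => ∑ m ∈ A i, w i m • h i m := by
    ext i j
    simp
  rw [e]
  refine this.trans (Finset.sum_congr rfl fun μ _ => ?_)
  exact (Matrix.detRowAlternating (R := K) (n := Fin n)).toMultilinearMap.map_smul_univ _ _

/-- After elimination, the factors x_j - y leave the columns and cancel the new part of the
Vandermonde product, while the factors (1 - b (i+1) y)⁻¹ leave the rows and cancel against the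
corner entry. -/
theorem alternantQuotient_succ (x a b : ℕ → K) (n : ℕ) (l : ℕ → ℕ)
    (hl : Antitone l)
    (ha : ∀ k m, 1 - a k * x m ≠ 0) (hb : ∀ k m, 1 - b k * x m ≠ 0) (hx0 : ∀ m, x m ≠ 0)
    (hx : Function.Injective x) :
    alternantQuotient x a b (n + 1) l = ∑ μ ∈ interlacing n l,
      alternantQuotient x a b n (extendZero μ) *
        ∏ i ∈ Finset.range (n + 1), ∏ j ∈ Finset.range (l i),
          branchFactor (x (n + 1)) a b l (extendZero μ) i j := by
  set y := x (n + 1) with hy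
  have hV : ∏ i : Fin n, (x (i + 1) - y) ≠ 0 := by
    refine Finset.prod_ne_zero_iff.mpr fun i _ => sub_ne_zero.mpr fun h => ?_
    have := hx h
    have := i.2
    omega
  have hB : ∏ i : Fin n, (1 - b (i + 1) * y) ≠ 0 :=
    Finset.prod_ne_zero_iff.mpr fun i _ => hb _ _
  have hdet : (Matrix.of fun i j : Fin (n + 1) =>
      alternantEntry a b (n + 1) i (l i) (x (j + 1))).det =
      alternantEntry a b (n + 1) n (l n) y * ((∏ i : Fin n, (x (i + 1) - y)) *
        ((∏ i : Fin n, (1 - b (i + 1) * y))⁻¹ * ∑ μ ∈ interlacing n l,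
          (∏ i : Fin n, rowFactor y a (b (i + 1)) (l (i + 1)) (l i) (μ i)) *
          (Matrix.of fun i j : Fin n => alternantEntry a b n i (μ i) (x (j + 1))).det)) := by
    refine (det_eliminate_last _ fun i => by
      simpa using alternantEntry_ne_zero a b _ _ _ _ (fun k => ha k _) (fun k => hb k _) (hx0 _)).trans ?_
    rw [interlacing, ← det_sum_rows _ _
      fun (i : Fin n) m (j : Fin n) => alternantEntry a b n i m (x (j + 1)), ← Finset.prod_inv_distrib, ← Matrix.det_mul_column,
      ← Matrix.det_mul_row]
    congr 1
    congr 1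
    ext i j
    simp only [Matrix.of_apply, Fin.val_castSucc, Fin.val_succ, Fin.val_last]
    exact alternantEntry_sub a b n i _ _ _ _ (fun k => ha k _) (fun k => ha k _) (fun k => hb k _)
      (hx0 _) (hl (Nat.le_succ _)) i.2
  have hlast : alternantEntry a b (n + 1) n (l n) y = (∏ i : Fin n, (1 - b (i + 1) * y)) *
      ∏ j ∈ Finset.range (l n), y / (1 - a (j + 1) * y) := by
    have e1 : ∀ (f : ℕ → K) m, ∏ k ∈ Finset.Icc 1 m, f k = ∏ k ∈ Finset.range m, f (k + 1) := by
      intro f m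
      rw [Finset.range_eq_Ico, Finset.prod_Ico_add' f 0 m 1]
      rfl
    rw [alternantEntry, e1, e1, Fin.prod_univ_eq_prod_range (fun i => 1 - b (i + 1) * y),
      Finset.prod_div_distrib]
    simp
    ring
  rw [alternantQuotient, prod_sub_castSucc, hdet, hlast]
  have hμ : ∀ μ ∈ interlacing n l, ∏ i ∈ Finset.range (n + 1), ∏ j ∈ Finset.range (l i),
      branchFactor y a b l (extendZero μ) i j =
        (∏ i : Fin n, rowFactor y a (b (i + 1)) (l (i + 1)) (l i) (μ i)) *
          ∏ j ∈ Finset.range (l n), y / (1 - a (j + 1) * y) := by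
    intro μ hμ
    rw [Finset.prod_range_succ, ← Fin.prod_univ_eq_prod_range]
    congr 1
    · refine Finset.prod_congr rfl fun i _ => ?_
      have := Finset.mem_Icc.mp (Fintype.mem_piFinset.mp hμ i)
      rw [prod_Ico_branchFactor, extendZero_fin] <;> rw [extendZero_fin]
      exacts [this.1, this.2]
    -- The shape μ has no row n, so every cell of that row of l is new.
    · refine Finset.prod_congr rfl fun j _ => ?_
      rw [branchFactor, if_pos (by rw [extendZero_of_le _ le_rfl]; omega)]
  simp only [alternantQuotient, extendZero_fin]
  rw [Finset.mul_sum, Finset.mul_sum, Finset.mul_sum, Finset.sum_div]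
  refine Finset.sum_congr rfl fun μ h => ?_
  rw [hμ μ h]
  generalize ∏ i : Fin n, (1 - b (i + 1) * y) = B at hB
  generalize ∏ i : Fin n, (x (i + 1) - y) = V at hV
  field_simp

end Branching

/-! ### Infinite sums in nonarchimedean rings -/

instance GRing.instNonarchimedeanRing : NonarchimedeanRing GRing where
  is_nonarchimedean U hU := by
    obtain ⟨I, hI, hIU⟩ := (IsLinearTopology.hasBasis_ideal (R := GRing)).mem_iff.mp hU
    exact ⟨⟨I.toAddSubgroup, AddSubgroup.isOpen_of_mem_nhds _ hI⟩, hIU⟩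

/-- Sum over a type that is partitioned into finitely many fibres. -/
theorem hasSum_of_fibers {R T ι : Type*} [AddCommMonoid R] [TopologicalSpace R] [ContinuousAdd R]
    {X : ι → Type*} {f : T → R} {a : ι → R} (I : Finset ι) (key : T → ι) (hkey : ∀ t, key t ∈ I)
    (φ : ∀ i ∈ I, X i → T) (hinj : ∀ i hi, Function.Injective (φ i hi))
    (hφ : ∀ i hi t, key t = i ↔ ∃ z, φ i hi z = t)
    (hsum : ∀ i hi, HasSum (fun z => f (φ i hi z)) (a i)) : HasSum f (∑ i ∈ I, a i) := by
  classical
  -- Each fibre sum is extended by zero to all of T; the finitely many extensions add up to f.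
  have h : ∀ i ∈ I, HasSum (fun t => if key t = i then f t else 0) (a i) := by
    intro i hi
    refine ((hinj i hi).hasSum_iff ?_).mp ?_
    · intro t ht
      rw [if_neg]
      exact fun hk => ht ((hφ i hi t).mp hk)
    · refine (hsum i hi).congr_fun ?_
      intro z
      simp [(hφ i hi (φ i hi z)).mpr ⟨z, rfl⟩]
  refine (hasSum_sum h).congr_fun fun t => ?_
  simp [hkey t]

/-- In a nonarchimedean ring the product of two summable families is summable over pairs, so
induction on the number of factors applies. -/
theorem hasSum_pi_prod_fin {R : Type*} [CommRing R] [UniformSpace R] [IsUniformAddGroup R]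
    [NonarchimedeanRing R] {n : ℕ} {X : Fin n → Type*} {f : ∀ i, X i → R} {a : Fin n → R}
    (h : ∀ i, HasSum (f i) (a i)) :
    HasSum (fun z : ∀ i, X i => ∏ i, f i (z i)) (∏ i, a i) := by
  induction n with
  | zero => exact hasSum_unique (fun z : ∀ i, X i => ∏ i, f i (z i))
  | succ n ih =>
    rw [Fin.prod_univ_succ, ← (Fin.consEquiv X).hasSum_iff]
    have := (h 0).mul_of_nonarchimedean (ih fun i => h i.succ)
    convert this using 2 with z
    simp [Fin.prod_univ_succ, Fin.consEquiv]

theorem hasSum_pi_prod {R : Type*} [CommRing R] [UniformSpace R] [IsUniformAddGroup R]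
    [NonarchimedeanRing R] {ι : Type*} [Fintype ι] {X : ι → Type*} {f : ∀ i, X i → R} {a : ι → R}
    (h : ∀ i, HasSum (f i) (a i)) :
    HasSum (fun z : ∀ i, X i => ∏ i, f i (z i)) (∏ i, a i) := by
  let e := (Fintype.equivFin ι).symm
  have := hasSum_pi_prod_fin fun i => h (e i)
  rw [← e.prod_comp, ← (Equiv.piCongrLeft X e).hasSum_iff]
  convert this using 2 with z
  rw [Function.comp_apply, ← e.prod_comp]
  simp

/-! ### Generating series of the letters appended to one cell -/

/-- The geometric series in `α_k x_m`. -/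
noncomputable def GRing.geom (k m : ℕ) : GRing := ∑' r : ℕ, (GRing.a k * GRing.x m) ^ r

theorem GRing.constantCoeff_a_mul_x (k m : ℕ) :
    MvPowerSeries.constantCoeff (GRing.a k * GRing.x m) = 0 := by
  simp [GRing.a]

theorem GRing.hasSum_geom (k m : ℕ) :
    HasSum (fun r : ℕ => (GRing.a k * GRing.x m) ^ r) (GRing.geom k m) :=
  (MvPowerSeries.WithPiTopology.summable_pow_of_constantCoeff_eq_zero
    (GRing.constantCoeff_a_mul_x k m)).hasSum

theorem GRing.geom_mul (k m : ℕ) : GRing.geom k m * (1 - GRing.a k * GRing.x m) = 1 :=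
  MvPowerSeries.WithPiTopology.tsum_pow_mul_one_sub_of_constantCoeff_eq_zero
    (GRing.constantCoeff_a_mul_x k m)

/-- The weight of a list of (marked) letters in the cell in row `i` and column `j`,
numbered from `0`. -/
noncomputable def cellWt (i j : ℕ) (L : List (ℕ × Bool)) : GRing :=
  (L.map fun p => GRing.x p.1).prod *
    GRing.a (j + 1) ^ (L.countP (fun p => p.2 = false) - 1) *
    (-GRing.b (i + 1)) ^ L.countP fun p => p.2 = true

/-- Marked multiset-valued fillings with letters at most `n` of the shape with row lengths `l`. -/
structure IsFilling (n : ℕ) (l : ℕ → ℕ) (e : ℕ → ℕ → List (ℕ × Bool)) : Prop where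
  outside : ∀ i j, l i ≤ j → e i j = []
  cell : ∀ i j, j < l i → IsMarkedMultiset (e i j)
  row_weak : ∀ i j, j + 1 < l i → ∀ p ∈ e i j, ∀ q ∈ e i (j + 1), p.1 ≤ q.1
  col_strict : ∀ i j, j < l (i + 1) → ∀ p ∈ e i j, ∀ q ∈ e (i + 1) j, p.1 < q.1
  le : ∀ i j, ∀ p ∈ e i j, p.1 ≤ n

/-- The weight of a filling of a shape with at most `n` rows. -/
noncomputable def fillingWt (n : ℕ) (l : ℕ → ℕ) (e : ℕ → ℕ → List (ℕ × Bool)) : GRing :=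
  ∏ i ∈ Finset.range n, ∏ j ∈ Finset.range (l i), cellWt i j (e i j)

/-- The lists of letters `n + 1` that may be appended to the cell in row `i` and column `j` of a
filling of the shape `μ` with smaller letters, to obtain a filling of the shape `l`. -/
def IsExtension (n : ℕ) (l μ : ℕ → ℕ) (i j : ℕ) (s : List (ℕ × Bool)) : Prop :=
  if μ i ≤ j then ∃ k, s = List.replicate (k + 1) (n + 1, false)
  else if j + 1 = μ i ∧ l (i + 1) ≤ j then
    s = [] ∨ ∃ m k, s = (n + 1, m) :: List.replicate k (n + 1, false)
  else s = []

/-- The factor by which the weight of a cell changes when letters are appended. -/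
noncomputable def extensionWt (μ : ℕ → ℕ) (i j : ℕ) (s : List (ℕ × Bool)) : GRing :=
  (s.map fun p => GRing.x p.1).prod *
    GRing.a (j + 1) ^ (s.countP (fun p => p.2 = false) - if μ i ≤ j then 1 else 0) *
    (-GRing.b (i + 1)) ^ s.countP fun p => p.2 = true

/-- `branchFactor` as a power series. -/
noncomputable def branchSeries (n : ℕ) (l μ : ℕ → ℕ) (i j : ℕ) : GRing :=
  if μ i ≤ j then GRing.x (n + 1) * GRing.geom (j + 1) (n + 1)
  else if j + 1 = μ i ∧ l (i + 1) ≤ j then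
    (1 - GRing.b (i + 1) * GRing.x (n + 1)) * GRing.geom (j + 1) (n + 1)
  else 1

/-- The first letter of a new cell carries no α, so k+1 copies weigh x (αx)^k. -/
theorem hasSum_extension_new {P : List (ℕ × Bool) → Prop} {n i j : ℕ} {μ : ℕ → ℕ} (h : μ i ≤ j)
    (hP : ∀ s, P s ↔ ∃ k, s = List.replicate (k + 1) (n + 1, false)) :
    HasSum (fun s : {s // P s} => extensionWt μ i j s.1)
      (GRing.x (n + 1) * GRing.geom (j + 1) (n + 1)) := by
  let φ : ℕ → {s // P s} := fun k => ⟨List.replicate (k + 1) (n + 1, false), (hP _).mpr ⟨k, rfl⟩⟩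
  have hφ : Function.Bijective φ := by
    constructor
    · intro k k' hk
      have := congrArg (fun s => s.1.length) hk
      simpa [φ] using this
    · rintro ⟨s, hs⟩
      obtain ⟨k, rfl⟩ := (hP s).mp hs
      exact ⟨k, rfl⟩
  rw [← (Equiv.ofBijective φ hφ).hasSum_iff]
  refine ((GRing.hasSum_geom (j + 1) (n + 1)).mul_left (GRing.x (n + 1))).congr_fun fun k => ?_
  simp [φ, extensionWt, h, List.countP_replicate]
  ring

theorem hasSum_extension_corner {P : List (ℕ × Bool) → Prop} {n i j : ℕ} {μ : ℕ → ℕ} (h : j < μ i)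
    (hP : ∀ s, P s ↔ s = [] ∨ ∃ m k, s = (n + 1, m) :: List.replicate k (n + 1, false)) :
    HasSum (fun s : {s // P s} => extensionWt μ i j s.1)
      ((1 - GRing.b (i + 1) * GRing.x (n + 1)) * GRing.geom (j + 1) (n + 1)) := by
  have h' : ¬ μ i ≤ j := by omega
  -- `none` is the empty list and `some m` records the mark of the first appended letter; the
  -- remaining datum is the number of further copies.
  let φ : ∀ o : Option Bool, (o.elim Unit fun _ => ℕ) → {s // P s} := fun o => match o with
    | none => fun _ => ⟨[], (hP _).mpr (Or.inl rfl)⟩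
    | some m => fun (k : ℕ) => ⟨(n + 1, m) :: List.replicate k (n + 1, false),
        (hP _).mpr (Or.inr ⟨m, k, rfl⟩)⟩
  let v : Option Bool → GRing := fun o => o.elim 1 fun m =>
    (if m then -GRing.b (i + 1) else GRing.a (j + 1)) * GRing.x (n + 1) *
      GRing.geom (j + 1) (n + 1)
  have hv : (1 - GRing.b (i + 1) * GRing.x (n + 1)) * GRing.geom (j + 1) (n + 1) =
      ∑ o ∈ Finset.univ, v o := by
    simp only [v, Fintype.sum_option, Fintype.sum_bool]
    simp only [Option.elim, if_true, Bool.false_eq_true, if_false]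
    linear_combination GRing.geom_mul (j + 1) (n + 1)
  rw [hv]
  refine hasSum_of_fibers (X := fun o : Option Bool => o.elim Unit fun _ => ℕ) Finset.univ
    (fun s => s.1.head?.map Prod.snd) (fun _ => Finset.mem_univ _)
    (fun o _ => φ o) ?_ ?_ ?_
  · rintro (_ | m) - z z' hz
    · rfl
    · change ℕ at z z'
      have := congrArg (fun s => s.1.length) hz
      simpa [φ] using this
  · rintro o - ⟨s, hs⟩
    constructor
    · rintro rfl
      rcases (hP s).mp hs with rfl | ⟨m, k, rfl⟩
      · exact ⟨(), rfl⟩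
      · exact ⟨(k : ℕ), rfl⟩
    · rintro ⟨z, hz⟩
      rcases o with _ | m <;> rw [← hz] <;> rfl
  · rintro (_ | m) -
    · simp [φ, extensionWt, v]
    · refine ((GRing.hasSum_geom (j + 1) (n + 1)).mul_left
        ((if m then -GRing.b (i + 1) else GRing.a (j + 1)) * GRing.x (n + 1))).congr_fun
          fun k => ?_
      cases m <;> simp [φ, extensionWt, h', List.countP_replicate] <;> ring

theorem hasSum_extension (n : ℕ) (l μ : ℕ → ℕ) (i j : ℕ) :
    HasSum (fun s : {s // IsExtension n l μ i j s} => extensionWt μ i j s.1)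
      (branchSeries n l μ i j) := by
  rw [branchSeries]
  split_ifs with h1 h2
  · exact hasSum_extension_new h1 fun s => by rw [IsExtension, if_pos h1]
  · exact hasSum_extension_corner (by omega) fun s => by rw [IsExtension, if_neg h1, if_pos h2]
  · have hP : ∀ s, IsExtension n l μ i j s ↔ s = [] := fun s => by
      rw [IsExtension, if_neg h1, if_neg h2]
    let _ : Unique {s // IsExtension n l μ i j s} :=
      ⟨⟨⟨[], (hP _).mpr rfl⟩⟩, fun s => Subtype.ext ((hP _).mp s.2)⟩
    have := hasSum_unique fun s : {s // IsExtension n l μ i j s} => extensionWt μ i j s.1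
    rwa [(hP _).mp (default : {s // IsExtension n l μ i j s}).2, show extensionWt μ i j [] = 1 by
      simp [extensionWt]] at this

theorem IsExtension.fst_eq {n : ℕ} {l μ : ℕ → ℕ} {i j : ℕ} {s : List (ℕ × Bool)}
    (h : IsExtension n l μ i j s) {p : ℕ × Bool} (hp : p ∈ s) : p.1 = n + 1 := by
  unfold IsExtension at h
  split_ifs at h
  · obtain ⟨k, rfl⟩ := h
    rw [List.eq_of_mem_replicate hp]
  · rcases h with rfl | ⟨m, k, rfl⟩
    · simp at hp
    · rcases List.mem_cons.mp hp with rfl | hp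
      · rfl
      · rw [List.eq_of_mem_replicate hp]
  · simp [h] at hp

theorem IsExtension.eq_nil {n : ℕ} {l μ : ℕ → ℕ} {i j : ℕ} {s : List (ℕ × Bool)}
    (h : IsExtension n l μ i j s) (h1 : j < μ i) (h2 : j + 1 < μ i ∨ j < l (i + 1)) : s = [] := by
  rwa [IsExtension, if_neg (by omega), if_neg (by omega)] at h

/-! ### Splitting a marked multiset at its largest letter -/

theorem IsMarkedMultiset.pairwise {L : List (ℕ × Bool)} (h : IsMarkedMultiset L) :
    L.Pairwise fun p q => p.1 ≤ q.1 := by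
  have : IsTrans (ℕ × Bool) fun p q => p.1 ≤ q.1 := ⟨fun _ _ _ => le_trans⟩
  exact (h.chain.imp fun _ _ h => h.1).pairwise

theorem IsMarkedMultiset.countP_pos {L : List (ℕ × Bool)} (h : IsMarkedMultiset L) :
    0 < L.countP fun p => p.2 = false := by
  rcases L with _ | ⟨p, L⟩
  · exact absurd rfl h.ne_nil
  · exact List.countP_pos_iff.mpr ⟨p, by simp, by simpa using h.head_unmarked p⟩

/-- A sorted list of letters at most `n + 1` splits at the letters `n + 1`. -/
theorem filter_append_filter {n : ℕ} {L : List (ℕ × Bool)}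
    (h : L.Pairwise fun p q => p.1 ≤ q.1) :
    L.filter (fun p => p.1 ≤ n) ++ L.filter (fun p => n < p.1) = L := by
  induction L with
  | nil => rfl
  | cons p L ih =>
    rw [List.pairwise_cons] at h
    by_cases hp : p.1 ≤ n
    · rw [List.filter_cons_of_pos (by simpa using hp), List.filter_cons_of_neg (by simpa using hp),
        List.cons_append, ih h.2]
    · have h1 : L.filter (fun p => p.1 ≤ n) = [] := by
        rw [List.filter_eq_nil_iff]
        intro q hq
        have := h.1 q hq
        simp; omega
      have h2 : L.filter (fun p => n < p.1) = L := by
        rw [List.filter_eq_self]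
        intro q hq
        have := h.1 q hq
        simp; omega
      rw [List.filter_cons_of_neg (by simpa using hp),
        List.filter_cons_of_pos (by simpa using hp), h1, h2, List.nil_append]

/-- A mark requires a strict increase, so among equal letters only the first can be marked. -/
theorem eq_cons_replicate {n : ℕ} {s : List (ℕ × Bool)} (h : ∀ p ∈ s, p.1 = n + 1)
    (hc : s.IsChain fun p q => p.1 ≤ q.1 ∧ (q.2 = true → p.1 < q.1)) :
    s = [] ∨ ∃ m k, s = (n + 1, m) :: List.replicate k (n + 1, false) := by
  rcases s with _ | ⟨⟨p, m⟩, s⟩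
  · exact Or.inl rfl
  · right
    obtain rfl : p = n + 1 := h (p, m) (by simp)
    refine ⟨m, s.length, ?_⟩
    congr 1
    induction s generalizing m with
    | nil => rfl
    | cons q s ih =>
      rw [List.isChain_cons_cons] at hc
      obtain ⟨q, m'⟩ := q
      obtain rfl : q = n + 1 := h (q, m') (by simp)
      obtain rfl : m' = false := by simpa using hc.1.2
      rw [List.length_cons, List.replicate_succ, ← ih false (fun p hp => h p ?_) hc.2]
      exact List.mem_cons_of_mem _ hp

theorem isChain_cons_replicate (n : ℕ) (m : Bool) (k : ℕ) :
    ((n + 1, m) :: List.replicate k (n + 1, false)).IsChain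
      fun p q => p.1 ≤ q.1 ∧ (q.2 = true → p.1 < q.1) := by
  induction k generalizing m with
  | zero => simp
  | succ k ih =>
    rw [List.replicate_succ, List.isChain_cons_cons]
    exact ⟨by simp, ih false⟩

/-- The first n+1 may carry a mark because the last letter of L is at most n. -/
theorem IsMarkedMultiset.append {n : ℕ} {L s : List (ℕ × Bool)} (hL : IsMarkedMultiset L)
    (hn : ∀ p ∈ L, p.1 ≤ n)
    (hs : s = [] ∨ ∃ m k, s = (n + 1, m) :: List.replicate k (n + 1, false)) :
    IsMarkedMultiset (L ++ s) := by
  rcases hs with rfl | ⟨m, k, rfl⟩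
  · simpa using hL
  refine ⟨by simp, ?_, ?_, ?_⟩
  · intro p hp
    rcases List.mem_append.mp hp with hp | hp
    · exact hL.pos p hp
    · rcases List.mem_cons.mp hp with rfl | hp
      · simp
      · rw [List.eq_of_mem_replicate hp]; simp
  · have := hL.head_unmarked
    rcases L with _ | ⟨p, L⟩
    · exact absurd rfl hL.ne_nil
    · simpa using this
  · rw [List.isChain_append]
    refine ⟨hL.chain, isChain_cons_replicate n m k, ?_⟩
    intro p hp q hq
    have := hn p (List.mem_of_getLast? hp)
    obtain rfl : (n + 1, m) = q := by simpa using hq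
    simp; omega

/-! ### Removing and appending the largest letter in fillings -/

/-- The number of cells in row `i` of a filling that contain a letter at most `n`. -/
noncomputable def smallLen (n : ℕ) (e : ℕ → ℕ → List (ℕ × Bool)) (i : ℕ) : ℕ :=
  sInf {j | ∀ p ∈ e i j, n < p.1}

theorem smallLen_eq {n : ℕ} {e : ℕ → ℕ → List (ℕ × Bool)} {i m : ℕ}
    (h : ∀ j, j < m ↔ ∃ p ∈ e i j, p.1 ≤ n) : smallLen n e i = m := by
  have : {j | ∀ p ∈ e i j, n < p.1} = Set.Ici m := by
    ext j
    have := h j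
    simp only [Set.mem_ofPred_eq, Set.mem_Ici]
    constructor
    · intro hj
      by_contra hm
      obtain ⟨p, hp, hpn⟩ := this.mp (by omega)
      exact absurd (hj p hp) (by omega)
    · intro hj p hp
      by_contra hpn
      have := this.mpr ⟨p, hp, by omega⟩
      omega
  rw [smallLen, this]
  exact isLeast_Ici.csInf_eq

namespace IsFilling

variable {n : ℕ} {l : ℕ → ℕ} {e : ℕ → ℕ → List (ℕ × Bool)}

theorem exists_mem (h : IsFilling n l e) {i j : ℕ} (hj : j < l i) : ∃ p, p ∈ e i j :=
  List.exists_mem_of_ne_nil _ (h.cell i j hj).ne_nil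

theorem lt_of_mem (h : IsFilling n l e) {i j : ℕ} {p : ℕ × Bool} (hp : p ∈ e i j) : j < l i := by
  by_contra hj
  rw [h.outside i j (by omega)] at hp
  simp at hp

/-- Rows increase weakly and their cells are not empty, so the cells with a letter at most n form an
initial segment. -/
theorem lt_smallLen (h : IsFilling (n + 1) l e) (i j : ℕ) :
    j < smallLen n e i ↔ ∃ p ∈ e i j, p.1 ≤ n := by
  constructor
  · intro hj
    by_contra hp
    have : smallLen n e i ≤ j := Nat.sInf_le fun p hpm => by
      by_contra h1
      exact hp ⟨p, hpm, by omega⟩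
    omega
  · intro hp
    by_contra hj
    have hmem : smallLen n e i ∈ {j | ∀ p ∈ e i j, n < p.1} := by
      -- The entry just past the end of the row is empty, so the condition holds vacuously there.
      refine Nat.sInf_mem ⟨l i, ?_⟩
      simp [h.outside i (l i) le_rfl]
    have : ∀ j, smallLen n e i ≤ j → ∀ p ∈ e i j, n < p.1 := by
      intro j hj
      induction j, hj using Nat.le_induction with
      | base => exact hmem
      | succ j _ ih =>
        intro p hp
        have hjl := h.lt_of_mem hp
        obtain ⟨q, hq⟩ := h.exists_mem (show j < l i by omega)
        exact (ih q hq).trans_le (h.row_weak i j hjl q hq p hp)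
    obtain ⟨p, hpm, hpn⟩ := hp
    exact absurd (this j (by omega) p hpm) (by omega)

/-- Columns increase strictly from a positive letter. Hence letters at most n occupy only the first
n rows. -/
theorem lt_fst (h : IsFilling n l e) (hl : Antitone l) :
    ∀ (i j : ℕ), ∀ p ∈ e i j, i < p.1 := by
  intro i
  induction i with
  | zero => exact fun j p hp => (h.cell 0 j (h.lt_of_mem hp)).pos p hp
  | succ i ih =>
    intro j p hp
    have hj := h.lt_of_mem hp
    obtain ⟨q, hq⟩ := h.exists_mem (hj.trans_le (hl (Nat.le_succ i)))
    have := ih j q hq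
    have := h.col_strict i j hj q hq p hp
    omega

theorem smallLen_le (h : IsFilling (n + 1) l e) (i : ℕ) : smallLen n e i ≤ l i := by
  by_contra hi
  obtain ⟨p, hp, -⟩ := (h.lt_smallLen i (l i)).mp (by omega)
  exact absurd (h.lt_of_mem hp) (lt_irrefl _)

/-- The erased cells form a horizontal strip: a cell above another one has letters smaller than n+1.
-/
theorem le_smallLen (h : IsFilling (n + 1) l e) (hl : Antitone l) (i : ℕ) :
    l (i + 1) ≤ smallLen n e i := by
  by_contra hi
  obtain ⟨q, hq⟩ := h.exists_mem (not_le.mp hi)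
  obtain ⟨p, hp⟩ := h.exists_mem ((not_le.mp hi).trans_le (hl (Nat.le_succ i)))
  have h1 := h.col_strict i _ (not_le.mp hi) p hp q hq
  have h2 := h.le _ _ q hq
  exact lt_irrefl _ ((h.lt_smallLen i _).mpr ⟨p, hp, by omega⟩)

theorem smallLen_eq_zero (h : IsFilling (n + 1) l e) (hl : Antitone l) {i : ℕ} (hi : n ≤ i) :
    smallLen n e i = 0 := by
  by_contra h0
  obtain ⟨p, hp, hpn⟩ := (h.lt_smallLen i 0).mp (by omega)
  have := h.lt_fst hl i 0 p hp
  omega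

theorem extendZero_smallLen (h : IsFilling (n + 1) l e) (hl : Antitone l) :
    extendZero (fun i : Fin n => smallLen n e i) = smallLen n e := by
  funext i
  rw [extendZero]
  split_ifs with hi
  · rfl
  · exact (h.smallLen_eq_zero hl (by omega)).symm

/-- The letters at most `n` of a filling. -/
theorem filter_le (h : IsFilling (n + 1) l e) :
    IsFilling n (smallLen n e) fun i j => (e i j).filter fun p => p.1 ≤ n where
  outside i j hj := by
    rw [List.filter_eq_nil_iff]
    intro p hp hpn
    have := (h.lt_smallLen i j).mpr ⟨p, hp, by simpa using hpn⟩
    omega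
  cell i j hj := by
    obtain ⟨p, hp, hpn⟩ := (h.lt_smallLen i j).mp hj
    have hc := h.cell i j (h.lt_of_mem hp)
    have hne : (e i j).filter (fun p => p.1 ≤ n) ≠ [] :=
      List.ne_nil_of_mem (List.mem_filter.mpr ⟨hp, by simpa using hpn⟩)
    have heq := filter_append_filter (n := n) hc.pairwise
    refine ⟨hne, fun q hq => hc.pos q (List.mem_filter.mp hq).1, ?_, ?_⟩
    · intro q hq
      refine hc.head_unmarked q ?_
      rw [← heq, List.head?_append_of_ne_nil _ hne]
      exact hq
    · have := hc.chain
      rw [← heq] at this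
      exact (List.isChain_append.mp this).1
  row_weak i j hj p hp q hq := by
    obtain ⟨r, hr, -⟩ := (h.lt_smallLen i _).mp hj
    exact h.row_weak i j (h.lt_of_mem hr) p (List.mem_filter.mp hp).1 q (List.mem_filter.mp hq).1
  col_strict i j hj p hp q hq := by
    obtain ⟨r, hr, -⟩ := (h.lt_smallLen (i + 1) _).mp hj
    exact h.col_strict i j (h.lt_of_mem hr) p (List.mem_filter.mp hp).1 q (List.mem_filter.mp hq).1
  le i j p hp := by simpa using (List.mem_filter.mp hp).2

/-- The letters `n + 1` of a filling. -/
theorem isExtension_filter (h : IsFilling (n + 1) l e) {i j : ℕ} (hj : j < l i) :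
    IsExtension n l (smallLen n e) i j ((e i j).filter fun p => n < p.1) := by
  have hc := h.cell i j hj
  have heq := filter_append_filter (n := n) hc.pairwise
  have hs : ∀ p ∈ (e i j).filter (fun p => n < p.1), p.1 = n + 1 := by
    intro p hp
    have := h.le i j p (List.mem_filter.mp hp).1
    have : n < p.1 := by simpa using (List.mem_filter.mp hp).2
    omega
  have hchain := hc.chain
  rw [← heq] at hchain
  have hrep := eq_cons_replicate hs (List.isChain_append.mp hchain).2.1
  rw [IsExtension]
  split_ifs with h1 h2
  · have h0 : (e i j).filter (fun p => p.1 ≤ n) = [] := h.filter_le.outside i j h1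
    rw [h0, List.nil_append] at heq
    rw [heq] at hrep ⊢
    rcases hrep with h3 | ⟨m, k, h3⟩
    · exact absurd h3 hc.ne_nil
    · refine ⟨k, ?_⟩
      -- With no smaller letters in the cell, the first n+1 is its head and cannot be marked.
      have := hc.head_unmarked (n + 1, m) (by rw [h3]; rfl)
      rw [h3, List.replicate_succ]
      simpa using this
  · exact hrep
  · rw [List.filter_eq_nil_iff]
    intro p hp hpn
    have hpn : n < p.1 := by simpa using hpn
    -- A letter n+1 here would exceed a small letter in the next cell of the row, or force a letter
    -- above n+1 in the cell below.
    by_cases h3 : j + 1 < smallLen n e i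
    · obtain ⟨q, hq, hqn⟩ := (h.lt_smallLen i _).mp h3
      have := h.row_weak i j (h.lt_of_mem hq) p hp q hq
      omega
    · have h4 : j < l (i + 1) := by omega
      obtain ⟨q, hq⟩ := h.exists_mem h4
      have := h.col_strict i j h4 p hp q hq
      have := h.le _ _ q hq
      omega

/-- Appending letters `n + 1` to a filling. -/
theorem append {μ : ℕ → ℕ} {s : ℕ → ℕ → List (ℕ × Bool)} (h : IsFilling n μ e)
    (hμl : ∀ i, μ i ≤ l i) (hlμ : ∀ i, l (i + 1) ≤ μ i)
    (hs : ∀ i j, j < l i → IsExtension n l μ i j (s i j)) (hs' : ∀ i j, l i ≤ j → s i j = []) :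
    IsFilling (n + 1) l fun i j => e i j ++ s i j := by
  have hsmem : ∀ {i j p}, p ∈ s i j → j < l i ∧ p.1 = n + 1 := by
    intro i j p hp
    by_cases hj : j < l i
    · exact ⟨hj, (hs i j hj).fst_eq hp⟩
    · rw [hs' i j (by omega)] at hp
      simp at hp
  have hle : ∀ i j, ∀ p ∈ e i j ++ s i j, p.1 ≤ n + 1 := by
    intro i j p hp
    rcases List.mem_append.mp hp with hp | hp
    · exact (h.le i j p hp).trans (Nat.le_succ n)
    · exact (hsmem hp).2.le
  refine ⟨?_, ?_, ?_, ?_, hle⟩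
  · intro i j hj
    rw [h.outside i j ((hμl i).trans hj), hs' i j hj, List.nil_append]
  · intro i j hj
    have hsj := hs i j hj
    by_cases h1 : μ i ≤ j
    · rw [IsExtension, if_pos h1] at hsj
      obtain ⟨k, hk⟩ := hsj
      rw [h.outside i j h1, hk, List.nil_append]
      refine ⟨by simp, ?_, by simp [List.replicate_succ], isChain_cons_replicate n false k⟩
      intro p hp
      rw [List.eq_of_mem_replicate hp]
      simp
    · refine (h.cell i j (by omega)).append (h.le i j) ?_
      rw [IsExtension, if_neg h1] at hsj
      split_ifs at hsj
      · exact hsj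
      · exact Or.inl hsj
  · intro i j hj p hp q hq
    rcases List.mem_append.mp hq with hq | hq
    · have hjμ := h.lt_of_mem hq
      rw [(hs i j (by omega)).eq_nil (by omega) (Or.inl hjμ), List.append_nil] at hp
      exact h.row_weak i j hjμ p hp q hq
    · rw [(hsmem hq).2]
      exact hle i j p hp
  · intro i j hj p hp q hq
    have := hlμ i
    have := hμl i
    rw [(hs i j (by omega)).eq_nil (by omega) (Or.inr hj), List.append_nil] at hp
    rcases List.mem_append.mp hq with hq | hq
    · exact h.col_strict i j (h.lt_of_mem hq) p hp q hq
    · have := (hsmem hq).2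
      have := h.le i j p hp
      omega

theorem smallLen_append {μ : ℕ → ℕ} {s : ℕ → ℕ → List (ℕ × Bool)} (h : IsFilling n μ e)
    (hs : ∀ i j, ∀ p ∈ s i j, p.1 = n + 1) :
    smallLen n (fun i j => e i j ++ s i j) = μ := by
  funext i
  refine smallLen_eq fun j => ?_
  constructor
  · intro hj
    obtain ⟨p, hp⟩ := h.exists_mem hj
    exact ⟨p, List.mem_append_left _ hp, h.le i j p hp⟩
  · rintro ⟨p, hp, hpn⟩
    rcases List.mem_append.mp hp with hp | hp
    · exact h.lt_of_mem hp
    · have := hs i j p hp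
      omega

theorem cellWt_append {μ : ℕ → ℕ} (h : IsFilling n μ e) (i j : ℕ) (s : List (ℕ × Bool)) :
    cellWt i j (e i j ++ s) = cellWt i j (e i j) * extensionWt μ i j s := by
  rw [cellWt, cellWt, extensionWt, List.map_append, List.prod_append, List.countP_append,
    List.countP_append, pow_add]
  split_ifs with h1
  -- For the empty list the truncated exponent 0 - 1 is 0, so `cellWt` is 1; the missing unit is
  -- subtracted in `extensionWt`.
  · rw [h.outside i j h1]
    simp
  · have := (h.cell i j (by omega)).countP_pos
    rw [Nat.sub_add_comm this, pow_add, Nat.sub_zero]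
    ring

theorem prod_cellWt {μ : ℕ → ℕ} (h : IsFilling n μ e) (hμl : ∀ i, μ i ≤ l i) (hμn : μ n = 0) :
    ∏ i ∈ Finset.range (n + 1), ∏ j ∈ Finset.range (l i), cellWt i j (e i j) =
      fillingWt n μ e := by
  have h1 : ∀ i j, μ i ≤ j → cellWt i j (e i j) = 1 := by
    intro i j hj
    simp [h.outside i j hj, cellWt]
  rw [Finset.prod_range_succ, fillingWt]
  rw [Finset.prod_eq_one (s := Finset.range (l n)) fun j _ => h1 n j (by omega), mul_one]
  refine Finset.prod_congr rfl fun i _ => ?_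
  refine (Finset.prod_subset (Finset.range_subset_range.mpr (hμl i)) fun j _ hj => ?_).symm
  exact h1 i j (by simpa using hj)

end IsFilling

/-! ### Interlacing shapes -/

section Interlacing

variable {n : ℕ} {l : ℕ → ℕ} {μ : Fin n → ℕ}

theorem extendZero_le (hμ : μ ∈ interlacing n l) (i : ℕ) : extendZero μ i ≤ l i := by
  rw [extendZero]
  split_ifs with hi
  · exact (Finset.mem_Icc.mp (Fintype.mem_piFinset.mp hμ ⟨i, hi⟩)).2
  · exact Nat.zero_le _

theorem le_extendZero (hμ : μ ∈ interlacing n l) (hl : Antitone l) (hln : l (n + 1) = 0) (i : ℕ) :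
    l (i + 1) ≤ extendZero μ i := by
  rw [extendZero]
  split_ifs with hi
  · exact (Finset.mem_Icc.mp (Fintype.mem_piFinset.mp hμ ⟨i, hi⟩)).1
  · exact (hl (by omega)).trans hln.le

theorem antitone_extendZero (hμ : μ ∈ interlacing n l) (hl : Antitone l) (hln : l (n + 1) = 0) :
    Antitone (extendZero μ) :=
  antitone_nat_of_succ_le fun i => (extendZero_le hμ _).trans (le_extendZero hμ hl hln i)

end Interlacing

/-! ### Summation over all fillings -/

/-- The generating series of fillings, by recursion on the largest letter. -/
noncomputable def fillingSeries : ℕ → (ℕ → ℕ) → GRing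
  | 0, _ => 1
  | n + 1, l => ∑ μ ∈ interlacing n l, fillingSeries n (extendZero μ) *
      ∏ i ∈ Finset.range (n + 1), ∏ j ∈ Finset.range (l i), branchSeries n l (extendZero μ) i j

/-- The cells of a shape with at most `n` rows. -/
abbrev shapeCells (n : ℕ) (l : ℕ → ℕ) : Finset (Σ _ : ℕ, ℕ) :=
  (Finset.range n).sigma fun i => Finset.range (l i)

/-- A choice of letters `n + 1` to be appended in every cell. -/
abbrev Extension (n : ℕ) (l μ : ℕ → ℕ) : Type :=
  ∀ c : shapeCells (n + 1) l, {s // IsExtension n l μ c.1.1 c.1.2 s}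

namespace Extension

variable {n : ℕ} {l μ : ℕ → ℕ}

/-- The appended letters, as a function on all pairs of indices. -/
def letters (s : Extension n l μ) (i j : ℕ) : List (ℕ × Bool) :=
  if h : ⟨i, j⟩ ∈ shapeCells (n + 1) l then (s ⟨_, h⟩).1 else []

theorem mem_shapeCells (hl : Antitone l) (hln : l (n + 1) = 0) {i j : ℕ} (hj : j < l i) :
    (⟨i, j⟩ : Σ _ : ℕ, ℕ) ∈ shapeCells (n + 1) l := by
  have : i < n + 1 := by
    by_contra hi
    have := hl (not_lt.mp hi)
    omega
  simp [this, hj]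

theorem isExtension_letters (hl : Antitone l) (hln : l (n + 1) = 0) (s : Extension n l μ)
    (i j : ℕ) (hj : j < l i) : IsExtension n l μ i j (s.letters i j) := by
  rw [letters, dif_pos (mem_shapeCells hl hln hj)]
  exact (s ⟨⟨i, j⟩, mem_shapeCells hl hln hj⟩).2

theorem letters_eq_nil (s : Extension n l μ) (i j : ℕ) (hj : l i ≤ j) : s.letters i j = [] := by
  rw [letters, dif_neg]
  simp
  omega

theorem fst_eq (s : Extension n l μ) (i j : ℕ) : ∀ p ∈ s.letters i j, p.1 = n + 1 := by
  intro p hp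
  rw [letters] at hp
  split_ifs at hp with h
  · exact (s ⟨_, h⟩).2.fst_eq hp
  · simp at hp

theorem letters_injective : Function.Injective (letters : Extension n l μ → _) := by
  intro s s' h
  funext c
  have := congrFun (congrFun h c.1.1) c.1.2
  rw [letters, letters, dif_pos c.2, dif_pos c.2] at this
  exact Subtype.ext this

theorem prod_extensionWt (s : Extension n l μ) :
    ∏ i ∈ Finset.range (n + 1), ∏ j ∈ Finset.range (l i), extensionWt μ i j (s.letters i j) =
      ∏ c : shapeCells (n + 1) l, extensionWt μ c.1.1 c.1.2 (s c).1 := by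
  rw [Finset.prod_sigma', ← Finset.prod_coe_sort]
  refine Finset.prod_congr rfl fun c _ => ?_
  rw [letters, dif_pos c.2]

end Extension

/-- A filling amounts to the shape μ of its letters at most n, a filling of μ and an independent
choice of appended letters in each cell. Weights multiply, and only finitely many μ occur. -/
theorem hasSum_fillingWt (n : ℕ) : ∀ l : ℕ → ℕ, Antitone l → l n = 0 →
    HasSum (fun e : {e // IsFilling n l e} => fillingWt n l e.1) (fillingSeries n l) := by
  induction n with
  | zero =>
    intro l hl hl0
    have hz : ∀ i, l i = 0 := fun i => by have := hl (Nat.zero_le i); omega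
    let _ : Unique {e // IsFilling 0 l e} :=
      { default := ⟨fun _ _ => [], fun _ _ _ => rfl, fun i j h => by simp [hz] at h, by simp,
          by simp, by simp⟩
        uniq := fun e => Subtype.ext (by
          funext i j
          exact e.2.outside i j (by simp [hz])) }
    simp [fillingWt, fillingSeries]
  | succ n ih =>
    intro l hl hln
    rw [fillingSeries]
    -- Filtering by size recovers both pieces of a concatenation, which gives injectivity of the
    -- gluing map.
    have hfil : ∀ {e e' : ℕ → ℕ → List (ℕ × Bool)}, (∀ i j, ∀ p ∈ e i j, p.1 ≤ n) →
        (∀ i j, ∀ p ∈ e' i j, p.1 = n + 1) → ∀ i j,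
        (e i j ++ e' i j).filter (fun p => p.1 ≤ n) = e i j ∧
          (e i j ++ e' i j).filter (fun p => n < p.1) = e' i j := by
      intro e e' h h' i j
      rw [List.filter_append, List.filter_append]
      rw [List.filter_eq_self.mpr fun p hp => by simpa using h i j p hp,
        List.filter_eq_nil_iff.mpr fun p hp => by rw [h' i j p hp]; simp,
        List.filter_eq_nil_iff.mpr fun p hp => by simpa using h i j p hp,
        List.filter_eq_self.mpr fun p hp => by rw [h' i j p hp]; simp]
      simp
    refine hasSum_of_fibers (interlacing n l)
      (X := fun μ => {e // IsFilling n (extendZero μ) e} × Extension n l (extendZero μ))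
      (fun e i => smallLen n e.1 i) ?_ (fun μ hμ z => ⟨fun i j => z.1.1 i j ++ z.2.letters i j,
        z.1.2.append (extendZero_le hμ) (le_extendZero hμ hl hln)
          (z.2.isExtension_letters hl hln) z.2.letters_eq_nil⟩) ?_ ?_ ?_
    · intro e
      exact Fintype.mem_piFinset.mpr fun i =>
        Finset.mem_Icc.mpr ⟨e.2.le_smallLen hl i, e.2.smallLen_le i⟩
    · rintro μ hμ ⟨e, s⟩ ⟨e', s'⟩ h
      have h1 := congrArg Subtype.val h
      simp only at h1
      have hf := hfil e.2.le s.fst_eq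
      have hf' := hfil e'.2.le s'.fst_eq
      refine Prod.ext (Subtype.ext ?_) (Extension.letters_injective ?_)
      · funext i j
        rw [← (hf i j).1, ← (hf' i j).1, congrFun (congrFun h1 i) j]
      · funext i j
        rw [← (hf i j).2, ← (hf' i j).2, congrFun (congrFun h1 i) j]
    · rintro μ hμ ⟨t, ht⟩
      constructor
      · rintro rfl
        have h1 := ht.filter_le
        rw [← ht.extendZero_smallLen hl] at h1
        refine ⟨⟨⟨_, h1⟩, fun c => ⟨(t c.1.1 c.1.2).filter fun p => n < p.1, ?_⟩⟩, ?_⟩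
        · have := ht.isExtension_filter (i := c.1.1) (j := c.1.2)
            (Finset.mem_range.mp (Finset.mem_sigma.mp c.2).2)
          rwa [← ht.extendZero_smallLen hl] at this
        · refine Subtype.ext ?_
          funext i j
          simp only [Extension.letters]
          split_ifs with h2
          · exact filter_append_filter (ht.cell i j (Finset.mem_range.mp (Finset.mem_sigma.mp h2).2)).pairwise
          · have : l i ≤ j := by
              by_contra h3
              exact h2 (Extension.mem_shapeCells hl hln (not_le.mp h3))
            simp [ht.outside i j this]
      · rintro ⟨z, hz⟩
        rw [← hz]
        simp only
        rw [z.1.2.smallLen_append z.2.fst_eq]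
        exact funext fun i => extendZero_fin μ i
    · intro μ hμ
      have h0 : extendZero μ n = 0 := extendZero_of_le μ le_rfl
      have h1 := ih (extendZero μ) (antitone_extendZero hμ hl hln) h0
      have h2 := hasSum_pi_prod fun c : shapeCells (n + 1) l =>
        hasSum_extension n l (extendZero μ) c.1.1 c.1.2
      rw [Finset.prod_sigma', ← Finset.prod_coe_sort]
      refine (h1.mul_of_nonarchimedean h2).congr_fun fun z => ?_
      rw [fillingWt]
      simp only [z.1.2.cellWt_append, Finset.prod_mul_distrib]
      rw [z.1.2.prod_cellWt (extendZero_le hμ) h0, Extension.prod_extensionWt]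

/-! ### Comparison in the fraction field and conclusion -/

theorem GField.algebraMap_injective : Function.Injective (algebraMap GRing GField) :=
  IsFractionRing.injective GRing GField

theorem GField.one_sub_ne_zero {f : GRing} (hf : MvPowerSeries.constantCoeff f = 0) :
    (1 : GField) - algebraMap GRing GField f ≠ 0 := by
  rw [← map_one (algebraMap GRing GField), ← map_sub]
  intro h
  have h1 : (1 : GRing) - f = 0 := algebraMap_injective (by rw [h, map_zero])
  have := congrArg MvPowerSeries.constantCoeff h1
  simp [hf] at this

theorem algebraMap_branchSeries (n : ℕ) (l μ : ℕ → ℕ) (i j : ℕ) :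
    algebraMap GRing GField (branchSeries n l μ i j) =
      branchFactor (GField.x (n + 1)) GField.a GField.b l μ i j := by
  have hg : algebraMap GRing GField (GRing.geom (j + 1) (n + 1)) =
      (1 - GField.a (j + 1) * GField.x (n + 1))⁻¹ := by
    refine eq_inv_of_mul_eq_one_left ?_
    rw [GField.a, GField.x, ← map_mul, ← map_one (algebraMap GRing GField), ← map_sub, ← map_mul,
      GRing.geom_mul]
  rw [branchSeries, branchFactor]
  split_ifs
  · rw [map_mul, hg]; rfl
  · rw [map_mul, hg, map_sub, map_mul, map_one]; rfl
  · exact map_one _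

/-- Both sides satisfy the same recursion, and both are 1 for n = 0. The factors 1 - αx and 1 - βx
are nonzero because their constant coefficient is 1. -/
theorem algebraMap_fillingSeries (n : ℕ) : ∀ l : ℕ → ℕ, Antitone l → l n = 0 →
    algebraMap GRing GField (fillingSeries n l) =
      alternantQuotient GField.x GField.a GField.b n l := by
  induction n with
  | zero =>
    intro l _ _
    simp [fillingSeries, alternantQuotient]
  | succ n ih =>
    intro l hl hln
    have hx : Function.Injective GField.x := by
      intro i j h
      have h1 := GField.algebraMap_injective h
      simpa using MvPowerSeries.X_inj.mp h1
    rw [alternantQuotient_succ _ _ _ n l hl ?_ ?_ ?_ hx, fillingSeries, map_sum]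
    · refine Finset.sum_congr rfl fun μ hμ => ?_
      rw [map_mul, ih _ (antitone_extendZero hμ hl hln) (extendZero_of_le μ le_rfl)]
      simp only [map_prod, algebraMap_branchSeries]
    · intro k m
      rw [GField.a, GField.x, ← map_mul]
      exact GField.one_sub_ne_zero (by simp [GRing.a])
    · intro k m
      rw [GField.b, GField.x, ← map_mul]
      exact GField.one_sub_ne_zero (by simp [GRing.b])
    · intro m h
      have h1 : GRing.x m = 0 := GField.algebraMap_injective (h.trans (map_zero _).symm)
      have := congrArg (MvPowerSeries.coeff (Finsupp.single (GVar.x m) 1)) h1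
      simp [GRing.x] at this

/-- Tableaux are fillings of the shape given by the row lengths. -/
def MMSVT.equivFilling (n : ℕ) (lam : YoungDiagram) :
    {T : MMSVT lam // T.MaxLE n} ≃ {e // IsFilling n lam.rowLen e} where
  toFun T := ⟨T.1.entry,
    fun i j h => T.1.outside i j (by rw [YoungDiagram.mem_iff_lt_rowLen]; omega),
    fun i j h => T.1.cell i j (YoungDiagram.mem_iff_lt_rowLen.mpr h),
    fun i j h => T.1.row_weak i j (YoungDiagram.mem_iff_lt_rowLen.mpr h),
    fun i j h => T.1.col_strict i j (YoungDiagram.mem_iff_lt_rowLen.mpr h), T.2⟩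
  invFun e := ⟨⟨e.1, fun i j h => e.2.outside i j (by
      rw [YoungDiagram.mem_iff_lt_rowLen] at h; omega),
    fun i j h => e.2.cell i j (YoungDiagram.mem_iff_lt_rowLen.mp h),
    fun i j h => e.2.row_weak i j (YoungDiagram.mem_iff_lt_rowLen.mp h),
    fun i j h => e.2.col_strict i j (YoungDiagram.mem_iff_lt_rowLen.mp h)⟩, e.2.le⟩

theorem corollary3p6 (n : ℕ) (lam : YoungDiagram) (hlam : lam.colLen 0 ≤ n) :
    ∃ S : GRing,
      HasSum (fun T : {T : MMSVT lam // T.MaxLE n} => T.1.wt) S ∧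
        refinedG n lam = algebraMap GRing GField S := by
  have hl : Antitone lam.rowLen := fun _ _ h => lam.rowLen_anti _ _ h
  have hln : lam.rowLen n = 0 := by
    by_contra h
    have h1 : (n, 0) ∈ lam := YoungDiagram.mem_iff_lt_rowLen.mpr (Nat.pos_of_ne_zero h)
    rw [YoungDiagram.mem_iff_lt_colLen] at h1
    omega
  -- `refinedG` unfolds to `alternantQuotient` for the row lengths of `lam`.
  refine ⟨fillingSeries n lam.rowLen, ?_, (algebraMap_fillingSeries n _ hl hln).symm⟩
  rw [← (MMSVT.equivFilling n lam).symm.hasSum_iff]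
  refine (hasSum_fillingWt n _ hl hln).congr_fun fun e => ?_
  rw [fillingWt, Finset.prod_sigma', Function.comp_apply, MMSVT.wt]
  refine (Finset.prod_bij (fun c _ => (c.1, c.2)) ?_ ?_ ?_ ?_).symm
  · intro c hc
    simp only [Finset.mem_sigma, Finset.mem_range] at hc
    exact (YoungDiagram.mem_cells _).mpr (YoungDiagram.mem_iff_lt_rowLen.mpr hc.2)
  · rintro ⟨i, j⟩ _ ⟨i', j'⟩ _ h
    simpa using h
  · rintro ⟨i, j⟩ hc
    refine ⟨⟨i, j⟩, ?_, rfl⟩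
    have h1 : j < lam.rowLen i :=
      YoungDiagram.mem_iff_lt_rowLen.mp ((YoungDiagram.mem_cells _).mp hc)
    simp only [Finset.mem_sigma, Finset.mem_range]
    refine ⟨?_, h1⟩
    by_contra hi
    have := hl (not_lt.mp hi)
    omega
  · intro c _
    rfl
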